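/- Let $k$ be an algebraically closed field of characteristic zero, let $n \ge 0$, let $A = k[x_1,\dots,x_n]$, and let $V = \operatorname{Der}_k(A)$ be the Lie algebra of $k$-linear derivations of $A$. An $AV$ module is an $A$-module $M$ together with a representation of the Lie $k$-algebra $V$ on $M$ such that $$\eta(fm) = f(\eta m) + \eta(f)\,m \qquad \text{for all } \eta \in V,\ f \in A,\ m \in M.$$ For a finitely generated module $N$ over a Noetherian local ring $(R,\mathfrak m)$, let $\operatorname{depth}_R(N)$ be the supremum of the lengths $r$ of sequences $f_1,\dots,f_r \in \mathfrak m$ such that, for every $1\le i\le r$, multiplication by $f_i$ is injective on $N/(f_1N+\dots+f_{i-1}N)$; call $N$ maximal Cohen–Macaulay over $R$ if $\operatorname{depth}_R(N) = \dim R$. A finitely generated $A$-module $M$ is called maximal Cohen–Macaulay if $M_{\mathfrak p}$ is maximal Cohen–Macaulay over $A_{\mathfrak p}$ for every prime ideal $\mathfrak p$ of $A$. Proposition 4.4. If $M$ is a nonzero $AV$ module that is finitely generated over $A$, then $M$ is a maximal Cohen–Macaulay $A$-module. -/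

import Mathlib

/-- Let `A` be a commutative `k`-algebra and let `M` be an `A`-module which is also a
representation of the Lie `k`-algebra `Der_k(A)`. Then `M` is an `AV` module if the two actions
are compatible through the Leibniz rule `η (f m) = f (η m) + η(f) m`. -/
class IsAVModule (k A M : Type*) [CommRing k] [CommRing A] [Algebra k A]
    [AddCommGroup M] [Module k M] [Module A M] [IsScalarTower k A M]
    [LieRingModule (Derivation k A A) M] [LieModule k (Derivation k A A) M] : Prop where
  leibniz : ∀ (η : Derivation k A A) (f : A) (m : M), ⁅η, f • m⁆ = f • ⁅η, m⁆ + η f • m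

/-- The depth of a module `M` over a local ring `R`: the supremum of the lengths `r` of the
sequences `f₁, …, f_r` in the maximal ideal such that each `f_i` is a nonzerodivisor on
`M / (f₁ M + ⋯ + f_{i-1} M)`. If `M` is finitely generated and nonzero, then `M / (f₁, …, f_r) M`
is automatically nonzero by Nakayama's lemma; the zero module has depth `⊤`. -/
noncomputable def localDepth (R M : Type*) [CommRing R] [IsLocalRing R]
    [AddCommGroup M] [Module R M] : ℕ∞ :=
  ⨆ (rs : List R) (_ : ∀ f ∈ rs, f ∈ IsLocalRing.maximalIdeal R)
    (_ : RingTheory.Sequence.IsWeaklyRegular M rs), (rs.length : ℕ∞)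

/-- A finitely generated module over a local ring is maximal Cohen–Macaulay if its depth is the
Krull dimension of the ring. -/
structure IsLocalMaximalCohenMacaulay (R M : Type*) [CommRing R] [IsLocalRing R]
    [AddCommGroup M] [Module R M] : Prop where
  finite : Module.Finite R M
  depth_eq : (localDepth R M : WithBot ℕ∞) = ringKrullDim R

/-- A module `M` over a commutative ring `A` is maximal Cohen–Macaulay if `M_𝔭` is maximal
Cohen–Macaulay over the local ring `A_𝔭` for every prime `𝔭` of `A`. -/
def IsMaximalCohenMacaulay (A M : Type*) [CommRing A] [AddCommGroup M] [Module A M] : Prop :=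
  ∀ (p : Ideal A) [p.IsPrime],
    IsLocalMaximalCohenMacaulay (Localization.AtPrime p) (LocalizedModule p.primeCompl M)

/-! The module is in fact projective. The scalars `a` for which `a • id` has finite rank (is a
finite sum of maps `φ(·) m`) form an ideal, nonzero because `M` is generically free. Commuting with
the action of `∂ᵢ` preserves finite rank and sends `a • id` to `∂ᵢ a • id`, so the ideal is stable
under all `∂ᵢ`. In characteristic zero this forces it to contain `1` (`IsAVModule.projective`). Each
localization is then flat over a regular local ring, where a regular sequence of length `dim R`
stays weakly regular on the module; the support dimension bounds the depth above. -/

section Projectivity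

open TensorProduct

/-! ### Finite rank endomorphisms and connections -/

section Connection

variable {A M : Type*} [CommRing A] [AddCommGroup M] [Module A M]

/-- The commutator of an additive map satisfying the Leibniz rule with a finite rank endomorphism
is again a finite rank endomorphism. -/
lemma exists_commutator_mem_range_dualTensorHom (D : A → A)
    (hD : ∀ a b, D (a * b) = a * D b + D a * b) (hDadd : ∀ a b, D (a + b) = D a + D b)
    (δ : M → M) (hadd : ∀ x y, δ (x + y) = δ x + δ y)
    (hδ : ∀ (f : A) (x : M), δ (f • x) = f • δ x + D f • x)
    (g : M →ₗ[A] M) (hg : g ∈ LinearMap.range (dualTensorHom A M M)) :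
    ∃ g' ∈ LinearMap.range (dualTensorHom A M M), ∀ x, g' x = δ (g x) - g (δ x) := by
  have hzero : δ 0 = 0 := by simpa using hadd 0 0
  obtain ⟨t, rfl⟩ := hg
  induction t with
  | zero => exact ⟨0, zero_mem _, fun x ↦ by simp [hzero]⟩
  | add s t hs ht =>
    obtain ⟨g₁, h₁, e₁⟩ := hs
    obtain ⟨g₂, h₂, e₂⟩ := ht
    refine ⟨g₁ + g₂, add_mem h₁ h₂, fun x ↦ ?_⟩
    simp only [LinearMap.add_apply, e₁, e₂, map_add, hadd]
    abel
  | tmul φ m =>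
    -- The dual connection applied to `φ`: the two `D a` terms cancel, so `ψ` is `A`-linear.
    let ψ : Module.Dual A M :=
      { toFun := fun x ↦ D (φ x) - φ (δ x)
        map_add' := fun x y ↦ by simp only [map_add, hDadd, hadd]; ring
        map_smul' := fun a x ↦ by
          simp only [map_smul, map_add, hδ, smul_eq_mul, hD, RingHom.id_apply]; ring }
    refine ⟨dualTensorHom A M M (φ ⊗ₜ δ m + ψ ⊗ₜ m), ⟨_, rfl⟩, fun x ↦ ?_⟩
    simp only [map_add, LinearMap.add_apply, dualTensorHom_apply, hδ]
    simp only [ψ, LinearMap.coe_mk, AddHom.coe_mk, sub_smul]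
    abel

variable (A M) in
/-- The ideal of those `a` for which multiplication by `a` on `M` factors through a finite free
module. -/
noncomputable def finiteRankIdeal : Ideal A :=
  (LinearMap.range (dualTensorHom A M M)).comap (LinearMap.toSpanSingleton A (M →ₗ[A] M) 1)

lemma mem_finiteRankIdeal {a : A} :
    a ∈ finiteRankIdeal A M ↔ a • (1 : M →ₗ[A] M) ∈ LinearMap.range (dualTensorHom A M M) :=
  Iff.rfl

lemma derivation_mem_finiteRankIdeal (D : A → A)
    (hD : ∀ a b, D (a * b) = a * D b + D a * b) (hDadd : ∀ a b, D (a + b) = D a + D b)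
    (δ : M → M) (hadd : ∀ x y, δ (x + y) = δ x + δ y)
    (hδ : ∀ (f : A) (x : M), δ (f • x) = f • δ x + D f • x)
    {a : A} (ha : a ∈ finiteRankIdeal A M) : D a ∈ finiteRankIdeal A M := by
  obtain ⟨g, hg, h⟩ := exists_commutator_mem_range_dualTensorHom D hD hDadd δ hadd hδ _
    (mem_finiteRankIdeal.mp ha)
  rw [mem_finiteRankIdeal]
  convert hg
  ext x
  simp [h, hδ]

lemma projective_of_finiteRankIdeal_eq_top (h : finiteRankIdeal A M = ⊤) :
    Module.Projective A M := by
  apply Module.Projective.of_one_mem_range_dualTensorHom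
  have : (1 : A) ∈ finiteRankIdeal A M := h ▸ Submodule.mem_top
  simpa [mem_finiteRankIdeal] using this

lemma mem_finiteRankIdeal_of_mem_submodule (F : Submodule A M) [Module.Free A F]
    [Module.Finite A F] {a : A} (h : ∀ x : M, a • x ∈ F) : a ∈ finiteRankIdeal A M := by
  obtain ⟨t, ht⟩ := (dualTensorHom_bijective_of_finite_projective_right
    (R := A) (M := M) (N := F)).surjective (LinearMap.codRestrict F (a • (1 : M →ₗ[A] M)) h)
  refine ⟨F.subtype.lTensor _ t, ?_⟩
  rw [← LinearMap.comp_apply, dualTensorHom_comp_lTensor, LinearMap.comp_apply, ht]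
  ext x
  simp

/-- A maximal independent family spans a free `F` with `M ⧸ F` finitely generated torsion, so a
single nonzero `a` sends `M` into `F`. -/
lemma exists_ne_zero_mem_finiteRankIdeal [IsDomain A] [IsNoetherianRing A] [Module.Finite A M] :
    ∃ a ∈ finiteRankIdeal A M, a ≠ 0 := by
  obtain ⟨I, hI, hmax⟩ := exists_maximal_linearIndepOn A (id : M → M)
  let F : Submodule A M := Submodule.span A (Set.range fun i : I ↦ (i : M))
  have : Module.Free A F := Module.Free.of_basis (Module.Basis.span hI)
  have htors : Module.IsTorsion A (M ⧸ F) := by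
    intro x
    obtain ⟨x, rfl⟩ := F.mkQ_surjective x
    by_cases hx : x ∈ I
    · refine ⟨1, ?_⟩
      have : F.mkQ x = 0 := (Submodule.Quotient.mk_eq_zero _).mpr
        (Submodule.subset_span ⟨⟨x, hx⟩, rfl⟩)
      rw [this, smul_zero]
    · obtain ⟨a, ha, h⟩ := hmax x hx
      refine ⟨⟨a, mem_nonZeroDivisors_of_ne_zero ha⟩, ?_⟩
      change a • F.mkQ x = 0
      rw [← map_smul]
      refine (Submodule.Quotient.mk_eq_zero _).mpr ?_
      simpa [F] using h
  obtain ⟨a, ha, ha'⟩ := Submodule.annihilator_top_inter_nonZeroDivisors htors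
  refine ⟨a, mem_finiteRankIdeal_of_mem_submodule F fun x ↦ ?_, nonZeroDivisors.ne_zero ha'⟩
  have := Submodule.mem_annihilator.mp ha (F.mkQ x) trivial
  rw [← map_smul] at this
  exact (Submodule.Quotient.mk_eq_zero _).mp this

end Connection

/-- Differentiating in a variable of a top-degree monomial lowers the degree without giving zero, so
one descends to a nonzero constant. -/
lemma MvPolynomial.ideal_eq_top_of_pderiv_mem {k σ : Type*} [Field k] [CharZero k]
    (I : Ideal (MvPolynomial σ k)) (h : ∀ i, ∀ f ∈ I, pderiv i f ∈ I) {f : MvPolynomial σ k}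
    (hf : f ∈ I) (hf0 : f ≠ 0) : I = ⊤ := by
  induction hd : f.totalDegree using Nat.strong_induction_on generalizing f with
  | _ d ih =>
  subst hd
  by_cases h0 : f.totalDegree = 0
  · rw [totalDegree_eq_zero_iff_eq_C] at h0
    refine Ideal.eq_top_of_isUnit_mem _ hf ?_
    rw [h0]
    refine (isUnit_iff_ne_zero.mpr fun hc ↦ hf0 ?_).map C
    rw [h0, hc, map_zero]
  · obtain ⟨s, hs, hsd⟩ := Finset.exists_mem_eq_sup f.support (support_nonempty.mpr hf0)
      (fun s ↦ s.sum fun _ e ↦ e)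
    obtain ⟨i, hi⟩ : ∃ i, s i ≠ 0 := by
      by_contra! hall
      apply h0
      have : s = 0 := Finsupp.ext hall
      rw [totalDegree, hsd, this, Finsupp.sum_zero_index]
    have hle : Finsupp.single i 1 ≤ s := by
      simpa [Nat.one_le_iff_ne_zero] using hi
    refine ih (pderiv i f).totalDegree ?_ (h i f hf) ?_ rfl
    · rw [totalDegree, Finset.sup_lt_iff (Nat.pos_of_ne_zero h0)]
      intro m hm
      have hm' : m + Finsupp.single i 1 ∈ f.support := by
        rw [mem_support_iff, coeff_pderiv] at hm
        exact mem_support_iff.mpr (left_ne_zero_of_mul hm)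
      have := le_totalDegree hm'
      rw [Finsupp.sum_add_index' (by simp) (by simp)] at this
      simpa using this
    · intro hz
      have := congrArg (coeff (s - Finsupp.single i 1)) hz
      rw [coeff_pderiv, tsub_add_cancel_of_le hle, coeff_zero] at this
      rcases mul_eq_zero.mp this with h1 | h1
      · exact mem_support_iff.mp hs h1
      · exact Nat.cast_add_one_ne_zero _ h1

theorem IsAVModule.projective {k σ M : Type*} [Field k] [CharZero k] [Finite σ] [AddCommGroup M]
    [Module k M] [Module (MvPolynomial σ k) M] [IsScalarTower k (MvPolynomial σ k) M]
    [LieRingModule (Derivation k (MvPolynomial σ k) (MvPolynomial σ k)) M]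
    [LieModule k (Derivation k (MvPolynomial σ k) (MvPolynomial σ k)) M]
    [IsAVModule k (MvPolynomial σ k) M] [Module.Finite (MvPolynomial σ k) M] :
    Module.Projective (MvPolynomial σ k) M := by
  obtain ⟨f, hf, hf0⟩ := exists_ne_zero_mem_finiteRankIdeal (A := MvPolynomial σ k) (M := M)
  refine projective_of_finiteRankIdeal_eq_top
    (MvPolynomial.ideal_eq_top_of_pderiv_mem _ (fun i g hg ↦ ?_) hf hf0)
  refine derivation_mem_finiteRankIdeal (MvPolynomial.pderiv i) (fun a b ↦ ?_) (map_add _)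
    (fun x ↦ ⁅MvPolynomial.pderiv i, x⁆) (lie_add _) (IsAVModule.leibniz _) hg
  rw [Derivation.leibniz, smul_eq_mul, smul_eq_mul, mul_comm b]

end Projectivity

/-! ### Regular sequences and depth over regular local rings -/

section RegularSequences

open IsLocalRing RingTheory.Sequence Pointwise

/-- Prime avoidance, which tolerates the non-prime `𝔪 ^ 2`; Nakayama excludes `𝔪 ≤ 𝔪 ^ 2`. -/
lemma IsLocalRing.exists_mem_maximalIdeal_notMem_sq_notMem_minimalPrimes (R : Type*) [CommRing R]
    [IsLocalRing R] [IsNoetherianRing R] (h : ringKrullDim R ≠ 0) :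
    ∃ x ∈ maximalIdeal R, x ∉ maximalIdeal R ^ 2 ∧ ∀ p ∈ minimalPrimes R, x ∉ p := by
  have hmin : maximalIdeal R ∉ minimalPrimes R := by
    intro hm
    apply h
    rw [← maximalIdeal_height_eq_ringKrullDim]
    exact_mod_cast Ideal.height_eq_zero_iff.mpr hm
  by_contra! hcon
  have hsub : (maximalIdeal R : Set R) ⊆ ⋃ I ∈ insert (maximalIdeal R ^ 2) (minimalPrimes R),
      ((id I : Ideal R) : Set R) := by
    intro x hx
    by_cases hx2 : x ∈ maximalIdeal R ^ 2
    · exact Set.mem_biUnion (Set.mem_insert _ _) hx2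
    · obtain ⟨p, hp, hxp⟩ := hcon x hx hx2
      exact Set.mem_biUnion (Set.mem_insert_of_mem _ hp) hxp
  obtain ⟨I, hI, hle⟩ := (Ideal.subset_union_prime_finite
    ((minimalPrimes.finite_of_isNoetherianRing R).insert _) (maximalIdeal R ^ 2)
    (maximalIdeal R ^ 2) (fun I hI h1 _ ↦ ((hI.resolve_left h1).1.1))).mp hsub
  rcases hI with rfl | hI
  · have hbot : maximalIdeal R = ⊥ := by
      refine Submodule.eq_bot_of_le_smul_of_le_jacobson_bot (maximalIdeal R) _
        (IsNoetherian.noetherian _) ?_ (IsLocalRing.maximalIdeal_le_jacobson _)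
      rwa [smul_eq_mul, ← pow_two]
    refine hmin ⟨⟨inferInstance, bot_le⟩, fun _ _ _ ↦ ?_⟩
    rw [hbot]
    exact bot_le
  · have := hI.1.1
    exact hmin (((maximalIdeal.isMaximal R).eq_of_le this.ne_top hle) ▸ hI)

lemma IsLocalRing.exists_insert_erase_span_eq_maximalIdeal {R : Type*} [CommRing R] [IsLocalRing R]
    [DecidableEq R] (s : Finset R) (hs : Ideal.span (s : Set R) = maximalIdeal R) {x : R}
    (hx : x ∈ maximalIdeal R) (hx2 : x ∉ maximalIdeal R ^ 2) :
    ∃ y ∈ s, Ideal.span (insert x (s.erase y : Set R)) = maximalIdeal R := by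
  rw [← hs] at hx
  obtain ⟨a, -, ha⟩ := Submodule.mem_span_finset.mp hx
  obtain ⟨y, hy, hay⟩ : ∃ y ∈ s, a y ∉ maximalIdeal R := by
    by_contra! hcon
    apply hx2
    rw [← ha, pow_two]
    exact sum_mem fun y hy ↦ Ideal.mul_mem_mul (hcon y hy) (hs ▸ Ideal.subset_span hy)
  refine ⟨y, hy, le_antisymm ?_ ?_⟩
  · rw [← hs, Ideal.span_le, Set.insert_subset_iff]
    exact ⟨hx, fun z hz ↦ Ideal.subset_span (Finset.mem_of_mem_erase hz)⟩
  · have hu : IsUnit (a y) := by simpa using hay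
    have hmem : a y * y ∈ Ideal.span (insert x (s.erase y : Set R)) := by
      rw [← Finset.add_sum_erase _ _ hy] at ha
      rw [← smul_eq_mul, eq_sub_of_add_eq ha]
      refine sub_mem (Ideal.subset_span (Set.mem_insert _ _)) (sum_mem fun z hz ↦ ?_)
      exact Ideal.mul_mem_left _ _ (Ideal.subset_span (Set.mem_insert_of_mem _ hz))
    rw [← hs, Ideal.span_le]
    intro z hz
    by_cases hzy : z = y
    · subst hzy
      exact (Ideal.unit_mul_mem_iff_mem _ hu).mp hmem
    · exact Ideal.subset_span (Set.mem_insert_of_mem _ (Finset.mem_erase.mpr ⟨hzy, hz⟩))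

/-- A minimal prime `P ≤ (x)` avoids `x`, so `P = xP` and Nakayama gives `P = 0`. -/
lemma IsLocalRing.isDomain_of_isPrime_span_singleton {R : Type*} [CommRing R] [IsLocalRing R]
    [IsNoetherianRing R] {x : R} (hx : x ∈ maximalIdeal R) (hp : (Ideal.span {x}).IsPrime)
    (hmin : ∀ p ∈ minimalPrimes R, x ∉ p) : IsDomain R := by
  obtain ⟨P, hP, hle⟩ := Ideal.exists_minimalPrimes_le (I := (⊥ : Ideal R)) (J := Ideal.span {x})
    bot_le
  have hPp : P.IsPrime := hP.1.1
  have hbot : P = ⊥ := by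
    refine Submodule.eq_bot_of_le_smul_of_le_jacobson_bot (maximalIdeal R) _
      (IsNoetherian.noetherian _) (fun y hy ↦ ?_) (IsLocalRing.maximalIdeal_le_jacobson _)
    obtain ⟨r, rfl⟩ := Ideal.mem_span_singleton'.mp (hle hy)
    rw [mul_comm]
    exact Ideal.mul_mem_mul hx ((hPp.mem_or_mem hy).resolve_right (hmin P hP))
  rw [hbot] at hPp
  exact IsDomain.of_bot_isPrime R

/-- Being a domain is carried through the induction: it makes `(x)` prime, hence `R` a domain and
`x` regular. -/
theorem IsLocalRing.isDomain_and_exists_isWeaklyRegular (d : ℕ) (R : Type*) [CommRing R]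
    [IsLocalRing R] [IsNoetherianRing R] (s : Finset R)
    (hs : Ideal.span (s : Set R) = maximalIdeal R) (hcard : s.card = d) (hd : d ≤ ringKrullDim R) :
    IsDomain R ∧ ∃ rs : List R, (∀ r ∈ rs, r ∈ maximalIdeal R) ∧ IsWeaklyRegular R rs ∧
      rs.length = d := by
  classical
  induction d generalizing R with
  | zero =>
    have h0 : maximalIdeal R = ⊥ := by
      rw [← hs, Finset.card_eq_zero.mp hcard, Finset.coe_empty, Ideal.span_empty]
    have : IsField R := IsLocalRing.isField_iff_maximalIdeal_eq.mpr h0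
    exact ⟨this.isDomain, [], by simp, .nil R R, rfl⟩
  | succ d ih =>
    have hne : ringKrullDim R ≠ 0 := by
      intro h
      rw [h] at hd
      exact Nat.not_succ_le_zero d (by exact_mod_cast hd)
    obtain ⟨x, hx, hx2, hxmin⟩ := exists_mem_maximalIdeal_notMem_sq_notMem_minimalPrimes R hne
    obtain ⟨y, hy, hspan⟩ := exists_insert_erase_span_eq_maximalIdeal s hs hx hx2
    let q := Ideal.Quotient.mk (Ideal.span {x})
    have hxtop : Ideal.span {x} ≠ ⊤ := fun h ↦ by
      rw [Ideal.span_singleton_eq_top] at h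
      exact hx h
    have : Nontrivial (R ⧸ Ideal.span {x}) := Ideal.Quotient.nontrivial_iff.mpr hxtop
    have : IsLocalRing (R ⧸ Ideal.span {x}) := .of_surjective' q Ideal.Quotient.mk_surjective
    have hmax : (maximalIdeal R).map q = maximalIdeal (R ⧸ Ideal.span {x}) :=
      IsLocalRing.map_maximalIdeal_of_surjective q Ideal.Quotient.mk_surjective
    have hs' : Ideal.span (((s.erase y).image q : Finset _) : Set (R ⧸ Ideal.span {x})) =
        maximalIdeal (R ⧸ Ideal.span {x}) := by
      rw [← hmax, ← hspan, Ideal.map_span, Set.image_insert_eq]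
      have : q x = 0 := Ideal.Quotient.eq_zero_iff_mem.mpr (Ideal.mem_span_singleton_self x)
      rw [this, Finset.coe_image]
      exact (Ideal.span_insert_zero).symm
    have hdim : (d : WithBot ℕ∞) ≤ ringKrullDim (R ⧸ Ideal.span {x}) := by
      have h1 := (Nat.cast_succ (R := WithBot ℕ∞) d ▸ hd).trans
        (ringKrullDim_le_ringKrullDim_quotSMulTop_succ hx)
      have h2 : x • (⊤ : Ideal R) = Ideal.span {x} := by
        simp [← Submodule.ideal_span_singleton_smul]
      rw [h2] at h1
      exact (ENat.WithBot.add_le_add_one_right_iff).mp h1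
    -- Generators cannot merge in the quotient, since its dimension already requires `d` of them.
    have hcard' : ((s.erase y).image q).card = d := by
      refine le_antisymm (Finset.card_image_le.trans (by rw [Finset.card_erase_of_mem hy]; omega)) ?_
      have h1 := hdim.trans (ringKrullDim_le_spanFinrank_maximalIdeal (R := R ⧸ Ideal.span {x}))
      rw [← hs'] at h1
      have h2 := Submodule.spanFinrank_span_le_ncard_of_finite (R := R ⧸ Ideal.span {x})
        ((s.erase y).image q).finite_toSet
      rw [Set.ncard_coe_finset] at h2
      exact (Nat.cast_le.mp h1).trans h2
    obtain ⟨hdom, rs, hrs, hreg, hlen⟩ := ih (R ⧸ Ideal.span {x}) _ hs' hcard' hdim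
    have hR : IsDomain R := isDomain_of_isPrime_span_singleton hx
      ((Ideal.Quotient.isDomain_iff_prime _).mp hdom) hxmin
    have hx0 : x ≠ 0 := fun h ↦ hx2 (h ▸ zero_mem _)
    obtain ⟨ts, rfl⟩ : ∃ ts : List R, ts.map q = rs :=
      ⟨rs.map Quotient.out, by simp [q, Function.comp_def]⟩
    refine ⟨hR, x :: ts, ?_, .cons (fun a b h ↦ mul_left_cancel₀ hx0 h) ?_, by simpa using hlen⟩
    · simp only [List.mem_cons, forall_eq_or_imp]
      refine ⟨hx, fun r hr ↦ ?_⟩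
      have := hrs (q r) (List.mem_map_of_mem hr)
      exact fun h ↦ this (h.map q)
    · have h2 : x • (⊤ : Ideal R) = Ideal.span {x} := by
        simp [← Submodule.ideal_span_singleton_smul]
      exact ((Submodule.quotEquivOfEq _ _ h2).isWeaklyRegular_congr ts).mpr
        ((isWeaklyRegular_map_algebraMap_iff (R ⧸ Ideal.span {x}) (R ⧸ Ideal.span {x}) ts).mp hreg)

theorem IsRegularLocalRing.exists_isWeaklyRegular_length_eq (R : Type*) [CommRing R]
    [IsRegularLocalRing R] : ∃ rs : List R, (∀ r ∈ rs, r ∈ maximalIdeal R) ∧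
      IsWeaklyRegular R rs ∧ rs.length = ringKrullDim R := by
  obtain ⟨s, hs, hspan⟩ := (IsNoetherian.noetherian
    (maximalIdeal R)).exists_span_finset_card_eq_spanFinrank
  have hd := IsRegularLocalRing.spanFinrank_maximalIdeal (R := R)
  obtain ⟨-, rs, h1, h2, h3⟩ := isDomain_and_exists_isWeaklyRegular _ R s hspan rfl
    (by rw [hs]; exact hd.le)
  exact ⟨rs, h1, h2, by rw [h3, hs]; exact hd⟩

section Depth

variable {R N : Type*} [CommRing R] [IsLocalRing R] [AddCommGroup N] [Module R N]

lemma length_le_localDepth {rs : List R} (h : ∀ r ∈ rs, r ∈ maximalIdeal R)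
    (hreg : IsWeaklyRegular N rs) : (rs.length : ℕ∞) ≤ localDepth R N :=
  le_iSup_of_le rs (le_iSup_of_le h (le_iSup_of_le hreg le_rfl))

lemma localDepth_le_ringKrullDim [IsNoetherianRing R] [Module.Finite R N] [Nontrivial N] :
    (localDepth R N : WithBot ℕ∞) ≤ ringKrullDim R := by
  rw [← WithBot.coe_unbot (ringKrullDim R) ringKrullDim_ne_bot, WithBot.coe_le_coe]
  refine iSup_le fun rs ↦ iSup_le fun hmem ↦ iSup_le fun hreg ↦ ?_
  rw [← WithBot.coe_le_coe, WithBot.coe_unbot]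
  -- Each term of a regular sequence cuts the support dimension by exactly one.
  have hr := IsRegular.of_isWeaklyRegular_of_mem_maximalIdeal N hmem hreg
  have := hr.quot_ofList_smul_nontrivial ⊤
  refine le_trans ?_ (Module.supportDim_le_ringKrullDim R N)
  rw [← Module.supportDim_add_length_eq_supportDim_of_isRegular rs hr]
  exact le_add_of_nonneg_left (Order.krullDim_nonneg_iff.mpr (Module.nonempty_support_of_nontrivial.to_subtype))

lemma IsLocalMaximalCohenMacaulay.of_flat {R N : Type*} [CommRing R] [IsRegularLocalRing R]
    [AddCommGroup N] [Module R N] [Module.Finite R N] [Module.Flat R N] [Nontrivial N] :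
    IsLocalMaximalCohenMacaulay R N where
  finite := inferInstance
  depth_eq := by
    refine le_antisymm localDepth_le_ringKrullDim ?_
    obtain ⟨rs, hmem, hreg, hlen⟩ := IsRegularLocalRing.exists_isWeaklyRegular_length_eq R
    rw [← hlen]
    have h := (TensorProduct.lid R N).isWeaklyRegular_congr rs |>.mp
      (hreg.isWeaklyRegular_rTensor (M₂ := N))
    exact_mod_cast length_le_localDepth hmem h

end Depth

/-- Needed because a zero localization would have depth `⊤`. -/
lemma nontrivial_localizedModule_of_isTorsionFree {A M : Type*} [CommRing A] [IsDomain A]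
    [AddCommGroup M] [Module A M] [Module.IsTorsionFree A M] [Nontrivial M] (p : Ideal A)
    [p.IsPrime] : Nontrivial (LocalizedModule p.primeCompl M) := by
  obtain ⟨m, hm⟩ := exists_ne (0 : M)
  refine ⟨LocalizedModule.mkLinearMap p.primeCompl M m, 0, fun h ↦ ?_⟩
  obtain ⟨c, hc⟩ := (IsLocalizedModule.eq_zero_iff p.primeCompl _).mp h
  exact hm ((smul_eq_zero.mp hc).resolve_left fun h0 ↦ c.2 (h0 ▸ zero_mem p))

end RegularSequences

theorem proposition4p4 {k : Type*} [Field k] [IsAlgClosed k] [CharZero k] (n : ℕ)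
    {M : Type*} [AddCommGroup M] [Module k M] [Module (MvPolynomial (Fin n) k) M]
    [IsScalarTower k (MvPolynomial (Fin n) k) M]
    [LieRingModule
      (Derivation k (MvPolynomial (Fin n) k) (MvPolynomial (Fin n) k)) M]
    [LieModule k
      (Derivation k (MvPolynomial (Fin n) k) (MvPolynomial (Fin n) k)) M]
    [IsAVModule k (MvPolynomial (Fin n) k) M]
    [Module.Finite (MvPolynomial (Fin n) k) M] [Nontrivial M] :
    IsMaximalCohenMacaulay (MvPolynomial (Fin n) k) M := by
  intro p _
  have : Module.Projective (MvPolynomial (Fin n) k) M := IsAVModule.projective (k := k)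
  have : Nontrivial (LocalizedModule p.primeCompl M) :=
    nontrivial_localizedModule_of_isTorsionFree p
  have : Module.Finite (Localization.AtPrime p) (LocalizedModule p.primeCompl M) :=
    Module.Finite.of_isLocalizedModule p.primeCompl (LocalizedModule.mkLinearMap p.primeCompl M)
  have : Module.Flat (Localization.AtPrime p) (LocalizedModule p.primeCompl M) :=
    Module.Flat.localizedModule p.primeCompl
  exact IsLocalMaximalCohenMacaulay.of_flat
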